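/- Let $n\ge 1$ and $n_{\mathrm v}\ge 1$ be integers, and let $A$ be an $n\times n$ (complex) Hermitian matrix with largest eigenvalue $\lambda_{\max}$ and smallest eigenvalue $\lambda_{\min}$. Let $v_1,\dots,v_{n_{\mathrm v}}$ be independent random vectors, each uniformly distributed on the real unit hypersphere $\mathbb S^{n-1}=\{u\in\mathbb R^n:\|u\|_2=1\}$. Then, for every $\varepsilon>0$, $$\mathbb P\left[\left|\,n^{-1}\operatorname{tr}(A)-\frac1{n_{\mathrm v}}\sum_{\ell=1}^{n_{\mathrm v}}v_\ell^{\mathsf H}Av_\ell\right|>\varepsilon(\lambda_{\max}-\lambda_{\min})\right]\le 2n\exp\!\left(-n_{\mathrm v}(n+2)\varepsilon^2\right).$$ -/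

import Mathlib

open MeasureTheory ProbabilityTheory

namespace TraceEstimation

/-- The real unit hypersphere `𝕊ⁿ⁻¹`, the set of Euclidean unit vectors of `ℝⁿ`. -/
abbrev Hypersphere (n : ℕ) : Set (EuclideanSpace ℝ (Fin n)) :=
  Metric.sphere (0 : EuclideanSpace ℝ (Fin n)) 1

/-- The uniform distribution on the real unit hypersphere: surface measure, normalized to have
total mass one (for `1 ≤ n`). -/
noncomputable def uniformSphere (n : ℕ) : Measure (Hypersphere n) :=
  ((volume : Measure (EuclideanSpace ℝ (Fin n))).toSphere Set.univ)⁻¹ •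
    (volume : Measure (EuclideanSpace ℝ (Fin n))).toSphere

/-- The largest eigenvalue of a Hermitian matrix of positive size. -/
noncomputable def lambdaMax {n : ℕ} {A : Matrix (Fin n) (Fin n) ℂ} (hA : A.IsHermitian) : ℝ :=
  ⨆ i, hA.eigenvalues i

/-- The smallest eigenvalue of a Hermitian matrix of positive size. -/
noncomputable def lambdaMin {n : ℕ} {A : Matrix (Fin n) (Fin n) ℂ} (hA : A.IsHermitian) : ℝ :=
  ⨅ i, hA.eigenvalues i

/-- The quadratic form `vᴴ A v` of a complex matrix at a real vector `v`. -/
noncomputable def quadForm {n : ℕ} (A : Matrix (Fin n) (Fin n) ℂ)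
    (v : EuclideanSpace ℝ (Fin n)) : ℂ :=
  star (fun i => (v i : ℂ)) ⬝ᵥ A.mulVec (fun i => (v i : ℂ))

/-- The average `⟨vₗᴴ A vₗ⟩ = nᵥ⁻¹ ∑ₗ vₗᴴ A vₗ` of the quadratic trace estimators. -/
noncomputable def averagedEstimator {n nv : ℕ} (A : Matrix (Fin n) (Fin n) ℂ)
    (v : Fin nv → EuclideanSpace ℝ (Fin n)) : ℂ :=
  (nv : ℂ)⁻¹ * ∑ l, quadForm A (v l)

end TraceEstimation

/-! Only S = Re A matters: for real v, vᴴAv = vᵀSv, the traces agree, and S has quadratic form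
between l = λ_min and L = λ_max. Let q = vᵀSv, m = tr(S)/n and f(s) = E exp(s q). It suffices that q
- m is sub-Gaussian with variance proxy τ = (L-l)²/(2(n+2)); Chernoff for independent sums then
gives the bound with factor 2, and 2 ≤ 2n.

Rotation invariance of the sphere, differentiated in every coordinate plane, yields E[(2 tr S - 2n q
+ 4s(|Sv|² - q²)) exp(s q)] = 0 (`integral_exp_quadratic_identity`). Since (L-S)(S-l) ≥ 0, |Sv|² ≤
(l+L)q - lL, so f satisfies a second-order differential inequality, singular at s = 0.
`le_exp_of_second_order_inequality` integrates it to f(s) ≤ exp(ms + τs²/2) for s ≥ 0; replacing S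
by -S covers s < 0. -/

namespace TraceEstimation

/-! ### Differential inequality for the moment generating function -/

/-- A comparison principle for the singular second-order differential inequality satisfied by
moment generating functions of quadratic forms on the sphere. -/
theorem le_exp_of_second_order_inequality {n m l L : ℝ} (hn : 0 < n) {f f₁ f₂ : ℝ → ℝ}
    (hf : ∀ s, HasDerivAt f (f₁ s) s) (hf₁ : ∀ s, HasDerivAt f₁ (f₂ s) s)
    (hpos : ∀ s, 0 ≤ f s) (h0 : f 0 = 1)
    (hineq : ∀ s, 0 ≤ s →
      n * f₁ s ≤ n * m * f s + 2 * s * ((l + L) * f₁ s - l * L * f s - f₂ s))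
    {s : ℝ} (hs : 0 ≤ s) :
    f s ≤ Real.exp (m * s + (L - l) ^ 2 / (4 * (n + 2)) * s ^ 2) := by
  -- The target is f' ≤ (m + sτ) f. This τ is the value for which (n+2)τ/2 offsets -(L-l)²/4, the
  -- minimum of (a-l)(a-L) over real a.
  obtain ⟨τ, hτ⟩ : ∃ τ, τ = (L - l) ^ 2 / (2 * (n + 2)) := ⟨_, rfl⟩
  have hτ' : 2 * (n + 2) * τ = (L - l) ^ 2 := by rw [hτ]; field_simp
  have hτ2 : (L - l) ^ 2 / (4 * (n + 2)) = τ / 2 := by rw [hτ]; field_simp; ring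
  rw [hτ2]
  have hexp (q r x : ℝ) : HasDerivAt (fun x => Real.exp (q * x + r * x ^ 2))
      (Real.exp (q * x + r * x ^ 2) * (q + 2 * r * x)) x := by
    have h := (((hasDerivAt_id x).const_mul q).add ((hasDerivAt_pow 2 x).const_mul r)).exp
    refine h.congr_deriv ?_
    simp only [Pi.add_apply, id]
    push_cast
    ring
  have hh (x : ℝ) : HasDerivAt (fun x => (m + x * τ) * f x - f₁ x)
      (τ * f x + (m + x * τ) * f₁ x - f₂ x) x := by
    have h := ((((hasDerivAt_id x).mul_const τ).const_add m).mul (hf x)).sub (hf₁ x)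
    refine h.congr_deriv ?_
    simp
  -- The weight is an integrating factor: once `hineq` eliminates f₂ from K', all f₁ terms cancel.
  let K : ℝ → ℝ := fun x => x ^ (n / 2) *
    (Real.exp ((m - (l + L)) * x + τ / 2 * x ^ 2) * ((m + x * τ) * f x - f₁ x))
  have hKd (x : ℝ) (hx : 0 < x) : HasDerivAt K (x ^ (n / 2 - 1) *
      (Real.exp ((m - (l + L)) * x + τ / 2 * x ^ 2) *
      ((n / 2 + x * (m + x * τ - (l + L))) * ((m + x * τ) * f x - f₁ x) +
        x * (τ * f x + (m + x * τ) * f₁ x - f₂ x)))) x := by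
    have h := (Real.hasDerivAt_rpow_const (p := n / 2) (Or.inl hx.ne')).mul
      ((hexp (m - (l + L)) (τ / 2) x).mul (hh x))
    refine h.congr_deriv ?_
    have hx1 : x ^ (n / 2) = x * x ^ (n / 2 - 1) := by
      rw [Real.rpow_sub_one hx.ne']; field_simp
    rw [hx1, Pi.mul_apply]
    ring
  have hKmono : MonotoneOn K (Set.Ici 0) := by
    refine monotoneOn_of_hasDerivWithinAt_nonneg (convex_Ici 0) ?_ (f' := fun x =>
      x ^ (n / 2 - 1) * (Real.exp ((m - (l + L)) * x + τ / 2 * x ^ 2) *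
      ((n / 2 + x * (m + x * τ - (l + L))) * ((m + x * τ) * f x - f₁ x) +
        x * (τ * f x + (m + x * τ) * f₁ x - f₂ x)))) ?_ ?_
    · refine Continuous.continuousOn ?_
      have c1 : Continuous f := continuous_iff_continuousAt.2 fun x => (hf x).continuousAt
      have c2 : Continuous f₁ := continuous_iff_continuousAt.2 fun x => (hf₁ x).continuousAt
      have c3 : Continuous fun x : ℝ => x ^ (n / 2) :=
        Real.continuous_rpow_const (by positivity)
      fun_prop
    · intro x hx
      rw [interior_Ici] at hx
      exact (hKd x hx).hasDerivWithinAt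
    · intro x hx
      rw [interior_Ici] at hx
      have hx : 0 < x := hx
      refine mul_nonneg (Real.rpow_nonneg hx.le _) (mul_nonneg (Real.exp_nonneg _) ?_)
      have h1 := hineq x hx.le
      -- With a = m + xτ, what remains is at least x f ((n+2)τ/2 + (a-l)(a-L)), which is exactly x f
      -- (2a-l-L)²/4.
      have h2 : 0 ≤ x * f x * (2 * (m + x * τ) - (l + L)) ^ 2 :=
        mul_nonneg (mul_nonneg hx.le (hpos x)) (sq_nonneg _)
      have h3 : x * f x * (2 * (n + 2) * τ) = x * f x * (L - l) ^ 2 := by rw [hτ']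
      linarith
  have hcomp (x : ℝ) (hx : 0 < x) : f₁ x ≤ (m + x * τ) * f x := by
    have h := hKmono Set.self_mem_Ici hx.le hx.le
    -- The factor x^(n/2) vanishes at 0, so no initial value of f₁ is needed.
    have hK0 : K 0 = 0 := by
      simp only [K]
      rw [Real.zero_rpow (by positivity), zero_mul]
    rw [hK0] at h
    have h' := nonneg_of_mul_nonneg_right h (Real.rpow_pos_of_pos hx _)
    have h'' := nonneg_of_mul_nonneg_right h' (Real.exp_pos _)
    linarith
  have hanti : AntitoneOn (fun x => f x * Real.exp ((-m) * x + (-(τ / 2)) * x ^ 2))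
      (Set.Ici 0) := by
    have hd (x : ℝ) := (hf x).mul (hexp (-m) (-(τ / 2)) x)
    refine antitoneOn_of_hasDerivWithinAt_nonpos (convex_Ici 0)
      (fun x _ => (hd x).continuousAt.continuousWithinAt)
      (fun x _ => (hd x).hasDerivWithinAt) ?_
    intro x hx
    rw [interior_Ici] at hx
    have h := hcomp x hx
    have h2 := Real.exp_pos (-m * x + -(τ / 2) * x ^ 2)
    nlinarith [mul_le_mul_of_nonneg_right h h2.le]
  have h := hanti Set.self_mem_Ici hs hs
  simp only [h0] at h
  have he : Real.exp (-m * s + -(τ / 2) * s ^ 2) = (Real.exp (m * s + τ / 2 * s ^ 2))⁻¹ := by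
    rw [← Real.exp_neg]; congr 1; ring
  rw [he, ← div_eq_mul_inv] at h
  have h3 : f s / Real.exp (m * s + τ / 2 * s ^ 2) ≤ 1 := by simpa using h
  rwa [div_le_one (Real.exp_pos _)] at h3

/-! ### Rotation invariance of the surface measure -/

section Rotation

open scoped Pointwise

variable {E : Type*} [NormedAddCommGroup E] [InnerProductSpace ℝ E]

/-- The action of a linear isometry on the unit sphere. -/
def sphereMap (R : E ≃ₗᵢ[ℝ] E) (v : Metric.sphere (0 : E) 1) : Metric.sphere (0 : E) 1 :=
  ⟨R v, by simp⟩

theorem measurePreserving_sphereMap [FiniteDimensional ℝ E] [MeasurableSpace E] [BorelSpace E]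
    (R : E ≃ₗᵢ[ℝ] E) : MeasurePreserving (sphereMap R)
      (volume : Measure E).toSphere (volume : Measure E).toSphere := by
  have hc : Continuous (sphereMap R) := by
    unfold sphereMap
    fun_prop
  refine ⟨hc.measurable, ?_⟩
  ext s hs
  rw [Measure.map_apply hc.measurable hs, Measure.toSphere_apply' _ hs,
    Measure.toSphere_apply' _ (hc.measurable hs)]
  congr 1
  -- Surface measure is a multiple of the volume of the cone over a set; isometries commute with
  -- forming cones and preserve volume.
  have hset : Set.Ioo (0 : ℝ) 1 • (Subtype.val '' (sphereMap R ⁻¹' s)) =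
      R ⁻¹' (Set.Ioo (0 : ℝ) 1 • (Subtype.val '' s)) := by
    ext x
    simp only [Set.mem_smul, Set.mem_image, Set.mem_preimage]
    constructor
    · rintro ⟨r, hr, _, ⟨v, hv, rfl⟩, rfl⟩
      exact ⟨r, hr, _, ⟨sphereMap R v, hv, rfl⟩, by simp [sphereMap]⟩
    · rintro ⟨r, hr, _, ⟨v, hv, rfl⟩, h⟩
      refine ⟨r, hr, _, ⟨sphereMap R.symm v, ?_, rfl⟩, ?_⟩
      · have : sphereMap R (sphereMap R.symm v) = v := by
          ext; simp [sphereMap]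
        rwa [this]
      · apply R.injective
        simpa [sphereMap] using h
  rw [hset]
  exact R.measurePreserving.measure_preimage_equiv (f := R.toMeasurableEquiv) _

/-- The rotation by the angle `t` in the oriented plane spanned by `e` and `f`. -/
noncomputable def planeRotationMap (e f : E) (t : ℝ) : E →ₗ[ℝ] E where
  toFun v := v + ((Real.cos t - 1) * inner ℝ e v - Real.sin t * inner ℝ f v) • e +
    (Real.sin t * inner ℝ e v + (Real.cos t - 1) * inner ℝ f v) • f
  map_add' u v := by simp only [inner_add_right]; module
  map_smul' r v := by simp only [inner_smul_right, RingHom.id_apply]; module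

theorem norm_planeRotationMap {e f : E} (he : ‖e‖ = 1) (hf : ‖f‖ = 1) (hef : inner ℝ e f = 0)
    (t : ℝ) (v : E) : ‖planeRotationMap e f t v‖ = ‖v‖ := by
  have hee : inner ℝ e e = 1 := by simp [he]
  have hff : inner ℝ f f = 1 := by simp [hf]
  have hfe : inner ℝ f e = 0 := by rw [real_inner_comm, hef]
  rw [← sq_eq_sq₀ (norm_nonneg _) (norm_nonneg _), ← real_inner_self_eq_norm_sq,
    ← real_inner_self_eq_norm_sq]
  simp only [planeRotationMap, LinearMap.coe_mk, AddHom.coe_mk, inner_add_left, inner_add_right,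
    real_inner_smul_left, real_inner_smul_right, hee, hff, hef, hfe, real_inner_comm e v,
    real_inner_comm f v]
  have h := Real.sin_sq_add_cos_sq t
  linear_combination ((inner ℝ e v) ^ 2 + (inner ℝ f v) ^ 2) * h

/-- The rotation by the angle `t` in the oriented plane spanned by the orthonormal pair
`e`, `f`, as an isometry. -/
noncomputable def planeRotation [FiniteDimensional ℝ E] {e f : E} (he : ‖e‖ = 1) (hf : ‖f‖ = 1)
    (hef : inner ℝ e f = 0) (t : ℝ) : E ≃ₗᵢ[ℝ] E :=
  LinearIsometry.toLinearIsometryEquiv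
    ⟨planeRotationMap e f t, norm_planeRotationMap he hf hef t⟩ rfl

theorem hasDerivAt_planeRotationMap {e f : E} (he : ‖e‖ = 1) (hf : ‖f‖ = 1)
    (hef : inner ℝ e f = 0) (t : ℝ) (v : E) :
    HasDerivAt (fun t => planeRotationMap e f t v)
      (inner ℝ e (planeRotationMap e f t v) • f - inner ℝ f (planeRotationMap e f t v) • e) t := by
  have hee : inner ℝ e e = 1 := by simp [he]
  have hff : inner ℝ f f = 1 := by simp [hf]
  have hfe : inner ℝ f e = 0 := by rw [real_inner_comm, hef]
  have hc := (Real.hasDerivAt_cos t).sub_const 1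
  have hs := Real.hasDerivAt_sin t
  have h := (((((hc.mul_const (inner ℝ e v)).sub (hs.mul_const (inner ℝ f v))).smul_const
    e).const_add v).add
    (((hs.mul_const (inner ℝ e v)).add (hc.mul_const (inner ℝ f v))).smul_const f))
  refine h.congr_deriv ?_
  simp only [planeRotationMap, LinearMap.coe_mk, AddHom.coe_mk, inner_add_right,
    real_inner_smul_right, hee, hff, hef, hfe]
  module

/-- Infinitesimal rotation invariance of the surface measure of the unit sphere. -/
theorem integral_fderiv_infinitesimal_rotation [FiniteDimensional ℝ E] [MeasurableSpace E]
    [BorelSpace E] {e f : E} (he : ‖e‖ = 1) (hf : ‖f‖ = 1) (hef : inner ℝ e f = 0)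
    {φ : E → ℝ} (hφ : ContDiff ℝ 1 φ) :
    ∫ v : Metric.sphere (0 : E) 1, fderiv ℝ φ v (inner ℝ e (v : E) • f - inner ℝ f (v : E) • e)
      ∂(volume : Measure E).toSphere = 0 := by
  have hφ' : Continuous (fderiv ℝ φ) := hφ.continuous_fderiv one_ne_zero
  have hcont : Continuous fun x : E => fderiv ℝ φ x (inner ℝ e x • f - inner ℝ f x • e) := by
    fun_prop
  obtain ⟨C, hC⟩ := (isCompact_sphere (0 : E) 1).exists_bound_of_continuousOn hcont.continuousOn
  have hrot (t : ℝ) (v : Metric.sphere (0 : E) 1) :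
      planeRotationMap e f t v ∈ Metric.sphere (0 : E) 1 := by
    simp [norm_planeRotationMap he hf hef]
  have hrc (t : ℝ) : Continuous (planeRotationMap e f t) :=
    LinearMap.continuous_of_finiteDimensional _
  have hder (t : ℝ) (v : Metric.sphere (0 : E) 1) :
      HasDerivAt (fun t => φ (planeRotationMap e f t v))
        ((fun x : E => fderiv ℝ φ x (inner ℝ e x • f - inner ℝ f x • e))
          (planeRotationMap e f t v)) t :=
    ((hφ.differentiable one_ne_zero _).hasFDerivAt).comp_hasDerivAt t
      (hasDerivAt_planeRotationMap he hf hef t v)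
  have hmeas (t : ℝ) : Continuous fun v : Metric.sphere (0 : E) 1 =>
      φ (planeRotationMap e f t v) :=
    hφ.continuous.comp ((hrc t).comp continuous_subtype_val)
  have key := (hasDerivAt_integral_of_dominated_loc_of_deriv_le
    (μ := (volume : Measure E).toSphere) (bound := fun _ => C) (x₀ := (0 : ℝ))
    (F := fun t (v : Metric.sphere (0 : E) 1) => φ (planeRotationMap e f t v))
    (F' := fun t (v : Metric.sphere (0 : E) 1) =>
      (fun x : E => fderiv ℝ φ x (inner ℝ e x • f - inner ℝ f x • e))
          (planeRotationMap e f t v))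
    Filter.univ_mem
    (.of_forall fun t => (hmeas t).aestronglyMeasurable)
    ((hmeas 0).integrable_of_hasCompactSupport (HasCompactSupport.of_compactSpace _))
    ((hcont.comp ((hrc 0).comp continuous_subtype_val)).aestronglyMeasurable)
    (.of_forall fun v t _ => hC _ (hrot t v))
    (integrable_const C)
    (.of_forall fun v t _ => hder t v)).2
  -- By invariance the rotated integral is constant in t, so its derivative at 0, computed under the
  -- integral sign, vanishes.
  have hconst : (fun t => ∫ v : Metric.sphere (0 : E) 1, φ (planeRotationMap e f t v)
      ∂(volume : Measure E).toSphere) =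
      fun _ => ∫ v : Metric.sphere (0 : E) 1, φ v ∂(volume : Measure E).toSphere := by
    funext t
    have hp := measurePreserving_sphereMap (planeRotation he hf hef t)
    have h := integral_map (μ := (volume : Measure E).toSphere) hp.measurable.aemeasurable
      (f := fun v : Metric.sphere (0 : E) 1 => φ v)
      (hφ.continuous.comp continuous_subtype_val).aestronglyMeasurable
    rw [hp.map_eq] at h
    exact h.symm
  rw [hconst] at key
  have h := key.unique (hasDerivAt_const _ _)
  simpa [planeRotationMap] using h

end Rotation

/-! ### Integration by parts for exponentials of quadratic forms -/

open Matrix in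
/-- The sum over all coordinate planes of the squared infinitesimal rotations, applied to the
exponential of a quadratic form. -/
theorem sum_rotation_terms {n : ℕ} (S : Matrix (Fin n) (Fin n) ℝ) (hS : S.IsSymm)
    (x : Fin n → ℝ) (hx : ∑ i, x i ^ 2 = 1) (s : ℝ) :
    ∑ i, ∑ j, (((x i * (if i = j then 1 else 0) - x j) * (S *ᵥ x) j +
        x i * (x i * S j j - x j * S j i) -
        (x i - x j * (if i = j then 1 else 0)) * (S *ᵥ x) i -
        x j * (x i * S i j - x j * S i i)) +
      2 * s * (x i * (S *ᵥ x) j - x j * (S *ᵥ x) i) ^ 2) =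
      2 * S.trace - 2 * n * (x ⬝ᵥ S *ᵥ x) +
        4 * s * (∑ i, (S *ᵥ x) i ^ 2 - (x ⬝ᵥ S *ᵥ x) ^ 2) := by
  obtain ⟨y, hy⟩ : ∃ y, y = S *ᵥ x := ⟨_, rfl⟩
  rw [← hy]
  have hq : ∑ i, x i * y i = x ⬝ᵥ y := rfl
  have hrow (i : Fin n) : ∑ j, S i j * x j = y i := by rw [hy]; rfl
  have hcol (i : Fin n) : ∑ j, S j i * x j = y i := by
    rw [← hrow i]
    exact Finset.sum_congr rfl fun j _ => by rw [hS.apply]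
  have h1 : ∑ i, ∑ j, (x i * (if i = j then 1 else 0) - x j) * y j = (1 - n) * (x ⬝ᵥ y) := by
    simp only [sub_mul, Finset.sum_sub_distrib, mul_ite, mul_one, mul_zero, ite_mul, zero_mul,
      Finset.sum_ite_eq, Finset.mem_univ, if_true, hq]
    simp
  have h2 : ∑ i, ∑ j, x i * (x i * S j j - x j * S j i) = S.trace - x ⬝ᵥ y := by
    have (i : Fin n) : ∑ j, x i * (x i * S j j - x j * S j i) = x i ^ 2 * S.trace - x i * y i := by
      rw [← hcol i, Matrix.trace, Finset.mul_sum, Finset.mul_sum, ← Finset.sum_sub_distrib]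
      exact Finset.sum_congr rfl fun j _ => by rw [diag_apply]; ring
    simp only [this, Finset.sum_sub_distrib, ← Finset.sum_mul, hx, hq, one_mul]
  have h3 : ∑ i, ∑ j, (x i - x j * (if i = j then 1 else 0)) * y i = (n - 1) * (x ⬝ᵥ y) := by
    simp only [sub_mul, Finset.sum_sub_distrib, mul_ite, mul_one, mul_zero, ite_mul, zero_mul,
      Finset.sum_ite_eq, Finset.mem_univ, if_true, hq]
    simp [← Finset.mul_sum, hq]
  have h4 : ∑ i, ∑ j, x j * (x i * S i j - x j * S i i) = x ⬝ᵥ y - S.trace := by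
    have (i : Fin n) : ∑ j, x j * (x i * S i j - x j * S i i) = x i * y i - S i i := by
      have hSii : S i i = ∑ j, x j ^ 2 * S i i := by rw [← Finset.sum_mul, hx, one_mul]
      rw [← hrow i, hSii, Finset.mul_sum, ← Finset.sum_sub_distrib, ← hSii]
      exact Finset.sum_congr rfl fun j _ => by ring
    simp only [this, Finset.sum_sub_distrib, hq]
    rfl
  have h5 : ∑ i, ∑ j, 2 * s * (x i * y j - x j * y i) ^ 2 =
      4 * s * (∑ i, y i ^ 2 - (x ⬝ᵥ y) ^ 2) := by
    have (i j : Fin n) : 2 * s * (x i * y j - x j * y i) ^ 2 =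
        2 * s * (x i ^ 2 * y j ^ 2) + 2 * s * (y i ^ 2 * x j ^ 2) -
          4 * s * ((x i * y i) * (x j * y j)) := by ring
    simp only [this, Finset.sum_sub_distrib, Finset.sum_add_distrib, ← Finset.mul_sum,
      ← Finset.sum_mul, hx, hq]
    ring
  simp only [Finset.sum_sub_distrib (f := fun _ => _ - _),
    Finset.sum_sub_distrib (f := fun _ => _ + _), Finset.sum_add_distrib, h1, h2, h3, h4, h5]
  ring

-- Along a line in the direction w, the linear factors are affine in t and the exponent is
-- quadratic, so a one-variable product rule suffices. Symmetry of S merges the two cross terms of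
-- the exponent.
open Matrix in
theorem fderiv_rotation_exp_quadratic {n : ℕ} (S : Matrix (Fin n) (Fin n) ℝ) (hS : S.IsSymm)
    (s : ℝ) (i j : Fin n) (x : EuclideanSpace ℝ (Fin n))
    {φ : EuclideanSpace ℝ (Fin n) → ℝ} (hφ : DifferentiableAt ℝ φ x)
    (hφ_eq : ∀ z, φ z = (z i * (S *ᵥ z) j - z j * (S *ᵥ z) i) *
      Real.exp (s * (z ⬝ᵥ S *ᵥ z))) :
    fderiv ℝ φ x (x i • EuclideanSpace.single j 1 - x j • EuclideanSpace.single i 1) =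
      (((x i * (if i = j then 1 else 0) - x j) * (S *ᵥ x) j +
        x i * (x i * S j j - x j * S j i) -
        (x i - x j * (if i = j then 1 else 0)) * (S *ᵥ x) i -
        x j * (x i * S i j - x j * S i i)) +
      2 * s * (x i * (S *ᵥ x) j - x j * (S *ᵥ x) i) ^ 2) * Real.exp (s * (x ⬝ᵥ S *ᵥ x)) := by
  rw [← hφ.lineDeriv_eq_fderiv]
  obtain ⟨w, hw⟩ : ∃ w : EuclideanSpace ℝ (Fin n),
    w = x i • EuclideanSpace.single j 1 - x j • EuclideanSpace.single i 1 := ⟨_, rfl⟩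
  have hw' : (w : Fin n → ℝ) = x i • Pi.single j 1 - x j • Pi.single i 1 := by rw [hw]; rfl
  have hwi : w i = x i * (if i = j then 1 else 0) - x j := by simp [hw', Pi.single_apply]
  have hwj : w j = x i - x j * (if i = j then 1 else 0) := by
    simp [hw', Pi.single_apply, eq_comm]
  have hz (k : Fin n) : (S *ᵥ w) k = x i * S k j - x j * S k i := by
    simp [hw', mulVec_sub, mulVec_smul]
  have hwy : w ⬝ᵥ S *ᵥ x = x i * (S *ᵥ x) j - x j * (S *ᵥ x) i := by
    simp [hw', sub_dotProduct, smul_dotProduct]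
  have hxz : x ⬝ᵥ S *ᵥ w = w ⬝ᵥ S *ᵥ x := by
    rw [dotProduct_mulVec, ← mulVec_transpose, hS.eq, dotProduct_comm]
  rw [← hw]
  have hfun : (fun t : ℝ => φ (x + t • w)) = fun t : ℝ =>
      ((x i + t * w i) * ((S *ᵥ x) j + t * (S *ᵥ w) j) -
        (x j + t * w j) * ((S *ᵥ x) i + t * (S *ᵥ w) i)) *
      Real.exp (s * (x ⬝ᵥ S *ᵥ x + t * (2 * (w ⬝ᵥ S *ᵥ x)) + t ^ 2 * (w ⬝ᵥ S *ᵥ w))) := by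
    funext t
    rw [hφ_eq]
    simp only [WithLp.ofLp_add, WithLp.ofLp_smul, mulVec_add, mulVec_smul, Pi.add_apply,
      Pi.smul_apply, smul_eq_mul, add_dotProduct, dotProduct_add, smul_dotProduct,
      dotProduct_smul, hxz]
    congr 2
    ring
  have hd (a b : ℝ) : HasDerivAt (fun t : ℝ => a + t * b) b 0 := by
    simpa using ((hasDerivAt_id (0 : ℝ)).mul_const b).const_add a
  have he (a b c : ℝ) : HasDerivAt (fun t : ℝ => Real.exp (s * (a + t * b + t ^ 2 * c)))
      (Real.exp (s * a) * (s * b)) 0 := by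
    have h := (((hd a b).add ((hasDerivAt_pow 2 (0 : ℝ)).mul_const c)).const_mul s).exp
    refine h.congr_deriv ?_
    simp
  have h := (((hd (x i) (w i)).mul (hd ((S *ᵥ x) j) ((S *ᵥ w) j))).sub
    ((hd (x j) (w j)).mul (hd ((S *ᵥ x) i) ((S *ᵥ w) i)))).mul
    (he (x ⬝ᵥ S *ᵥ x) (2 * (w ⬝ᵥ S *ᵥ x)) (w ⬝ᵥ S *ᵥ w))
  rw [lineDeriv, hfun]
  refine (h.congr_deriv ?_).deriv
  simp only [hwi, hwj, hz, hwy, Pi.sub_apply, Pi.mul_apply, zero_mul, add_zero, ne_eq,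
    OfNat.ofNat_ne_zero, not_false_eq_true, zero_pow]
  ring

open Matrix in
/-- Integration by parts on the sphere for the exponential of a quadratic form. -/
theorem integral_exp_quadratic_identity {n : ℕ} (S : Matrix (Fin n) (Fin n) ℝ) (hS : S.IsSymm)
    (s : ℝ) :
    ∫ v : Hypersphere n, (2 * S.trace - 2 * n * (v.1 ⬝ᵥ S *ᵥ v.1) +
        4 * s * (∑ i, (S *ᵥ v.1) i ^ 2 - (v.1 ⬝ᵥ S *ᵥ v.1) ^ 2)) *
      Real.exp (s * (v.1 ⬝ᵥ S *ᵥ v.1))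
      ∂(volume : Measure (EuclideanSpace ℝ (Fin n))).toSphere = 0 := by
  -- Up to the factor 2s, this is the rotational derivative of exp(s q) in the (i, j) plane.
  -- Omitting that factor keeps the identity informative at s = 0.
  let φ (i j : Fin n) (z : EuclideanSpace ℝ (Fin n)) : ℝ :=
    (z i * (S *ᵥ z) j - z j * (S *ᵥ z) i) * Real.exp (s * (z ⬝ᵥ S *ᵥ z))
  have hφ (i j : Fin n) : ContDiff ℝ 1 (φ i j) := by
    have hc (k : Fin n) : ContDiff ℝ 1 fun z : EuclideanSpace ℝ (Fin n) => z k := by fun_prop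
    have hm (k : Fin n) : ContDiff ℝ 1 fun z : EuclideanSpace ℝ (Fin n) => (S *ᵥ z) k := by
      simp only [mulVec, dotProduct]
      fun_prop
    have hq : ContDiff ℝ 1 fun z : EuclideanSpace ℝ (Fin n) => z ⬝ᵥ S *ᵥ z := by
      simp only [dotProduct]
      fun_prop
    exact (((hc i).mul (hm j)).sub ((hc j).mul (hm i))).mul (contDiff_const.mul hq).exp
  have hzero (i j : Fin n) : ∫ v : Hypersphere n, fderiv ℝ (φ i j) v
      (v.1 i • EuclideanSpace.single j 1 - v.1 j • EuclideanSpace.single i 1)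
      ∂(volume : Measure (EuclideanSpace ℝ (Fin n))).toSphere = 0 := by
    by_cases hij : i = j
    · subst hij
      simp
    · have h := integral_fderiv_infinitesimal_rotation
        (e := EuclideanSpace.single i (1 : ℝ)) (f := EuclideanSpace.single j (1 : ℝ))
        (by simp) (by simp)
        (by rw [EuclideanSpace.inner_single_left]; simp [hij]) (hφ i j)
      simp only [EuclideanSpace.inner_single_left, map_one, one_mul] at h
      exact h
  have hint (i j : Fin n) : Integrable (fun v : Hypersphere n => fderiv ℝ (φ i j) v
      (v.1 i • EuclideanSpace.single j 1 - v.1 j • EuclideanSpace.single i 1))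
      (volume : Measure (EuclideanSpace ℝ (Fin n))).toSphere := by
    have hφ' : Continuous (fderiv ℝ (φ i j)) := (hφ i j).continuous_fderiv one_ne_zero
    exact Continuous.integrable_of_hasCompactSupport (by fun_prop)
      (HasCompactSupport.of_compactSpace _)
  have hsum := integral_finsetSum (μ := (volume : Measure (EuclideanSpace ℝ (Fin n))).toSphere)
    (Finset.univ : Finset (Fin n × Fin n)) (fun p _ => hint p.1 p.2)
  rw [Finset.sum_eq_zero (fun p _ => hzero p.1 p.2)] at hsum
  rw [← hsum]
  congr 1
  funext v
  have hv : ∑ i, v.1 i ^ 2 = 1 := by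
    rw [← EuclideanSpace.real_norm_sq_eq, norm_eq_of_mem_sphere v, one_pow]
  rw [← sum_rotation_terms S hS v.1 hv s, Fintype.sum_prod_type, Finset.sum_mul]
  refine Finset.sum_congr rfl fun i _ => ?_
  rw [Finset.sum_mul]
  refine Finset.sum_congr rfl fun j _ => ?_
  rw [fderiv_rotation_exp_quadratic S hS s i j v.1 ((hφ i j).differentiable one_ne_zero _)
    fun z => rfl]

/-! ### Sub-Gaussian bound for one random vector -/

theorem isProbabilityMeasure_uniformSphere {n : ℕ} (hn : 0 < n) :
    IsProbabilityMeasure (uniformSphere n) := by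
  have : Nonempty (Fin n) := ⟨⟨0, hn⟩⟩
  refine ⟨?_⟩
  rw [uniformSphere, Measure.smul_apply, smul_eq_mul]
  exact ENNReal.inv_mul_cancel
    (Measure.measure_univ_ne_zero.2 (Measure.toSphere_ne_zero _)) (measure_ne_top _ _)

-- This is (L-S)(S-l) ≥ 0 without diagonalising: (L-S)(S-l)² and (S-l)(L-S)² are positive
-- semidefinite, and their sum is (L-l)(L-S)(S-l).
open Matrix in
theorem dotProduct_mulVec_self_le {n : ℕ} {S : Matrix (Fin n) (Fin n) ℝ} (hS : S.IsSymm)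
    {l L : ℝ} (hlL : l < L) (hl : ∀ x, l * (x ⬝ᵥ x) ≤ x ⬝ᵥ S *ᵥ x)
    (hL : ∀ x, x ⬝ᵥ S *ᵥ x ≤ L * (x ⬝ᵥ x)) (x : Fin n → ℝ) :
    S *ᵥ x ⬝ᵥ S *ᵥ x ≤ (l + L) * (x ⬝ᵥ S *ᵥ x) - l * L * (x ⬝ᵥ x) := by
  have hsymm (u w : Fin n → ℝ) : u ⬝ᵥ S *ᵥ w = S *ᵥ u ⬝ᵥ w := by
    rw [dotProduct_mulVec, ← mulVec_transpose, hS.eq]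
  have h1 := hL (S *ᵥ x - l • x)
  have h2 := hl (L • x - S *ᵥ x)
  simp only [mulVec_sub, mulVec_smul, sub_dotProduct, dotProduct_sub, smul_dotProduct,
    dotProduct_smul, smul_eq_mul, hsymm x (S *ᵥ x), ← hsymm x x] at h1 h2
  refine le_of_mul_le_mul_left ?_ (sub_pos.2 hlL)
  linarith

open Matrix in
/-- The moment generating function of a quadratic form in a uniformly distributed unit vector
is bounded by that of a normal variable, for nonnegative arguments. -/
theorem integral_exp_quadratic_le {n : ℕ} (hn : 0 < n) {S : Matrix (Fin n) (Fin n) ℝ}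
    (hS : S.IsSymm) {l L : ℝ} (hlL : l < L) (hl : ∀ x, l * (x ⬝ᵥ x) ≤ x ⬝ᵥ S *ᵥ x)
    (hL : ∀ x, x ⬝ᵥ S *ᵥ x ≤ L * (x ⬝ᵥ x)) {s : ℝ} (hs : 0 ≤ s) :
    ∫ v : Hypersphere n, Real.exp (s * (v.1 ⬝ᵥ S *ᵥ v.1)) ∂uniformSphere n ≤
      Real.exp (S.trace / n * s + (L - l) ^ 2 / (4 * (n + 2)) * s ^ 2) := by
  have := isProbabilityMeasure_uniformSphere hn
  have hn' : (0 : ℝ) < n := by exact_mod_cast hn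
  obtain ⟨X, hX⟩ : ∃ X : Hypersphere n → ℝ, X = fun v => v.1 ⬝ᵥ S *ᵥ v.1 := ⟨_, rfl⟩
  have hXc : Continuous X := by
    rw [hX]
    simp only [dotProduct, mulVec]
    fun_prop
  have hint {g : Hypersphere n → ℝ} (hg : Continuous g) : Integrable g (uniformSphere n) :=
    hg.integrable_of_hasCompactSupport (HasCompactSupport.of_compactSpace _)
  have hset (t : ℝ) : t ∈ interior (integrableExpSet X (uniformSphere n)) := by
    have : integrableExpSet X (uniformSphere n) = Set.univ :=
      Set.eq_univ_of_forall fun t => hint (by fun_prop)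
    simp [this]
  let f (k : ℕ) (s : ℝ) : ℝ := ∫ v, X v ^ k * Real.exp (s * X v) ∂uniformSphere n
  have hf (k : ℕ) (s : ℝ) : HasDerivAt (f k) (f (k + 1) s) s :=
    hasDerivAt_integral_pow_mul_exp_real (hset s) k
  have hmain := le_exp_of_second_order_inequality (m := S.trace / n) (l := l) (L := L) hn'
    (hf 0) (hf 1) (fun s => integral_nonneg fun v => by simp [Real.exp_nonneg])
    (by simp [f]) ?_ hs
  · simpa [f, hX] using hmain
  intro s hs
  have hid := integral_exp_quadratic_identity S hS s
  have hid' : ∫ v : Hypersphere n, (2 * S.trace - 2 * n * X v +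
        4 * s * (∑ i, (S *ᵥ v.1) i ^ 2 - X v ^ 2)) * Real.exp (s * X v) ∂uniformSphere n = 0 := by
    rw [uniformSphere, integral_smul_measure, hX, hid, smul_zero]
  have hle : ∫ v : Hypersphere n, (2 * S.trace - 2 * n * X v +
        4 * s * (∑ i, (S *ᵥ v.1) i ^ 2 - X v ^ 2)) * Real.exp (s * X v) ∂uniformSphere n ≤
      ∫ v : Hypersphere n, ((2 * S.trace - 4 * s * (l * L)) * (X v ^ 0 * Real.exp (s * X v)) +
        (4 * s * (l + L) - 2 * n) * (X v ^ 1 * Real.exp (s * X v)) -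
        4 * s * (X v ^ 2 * Real.exp (s * X v))) ∂uniformSphere n := by
    refine integral_mono (hint ?_) (hint (by fun_prop)) fun v => ?_
    · simp only [mulVec, dotProduct]
      fun_prop
    · have hv : v.1 ⬝ᵥ v.1 = 1 := by
        have h : ∑ i, v.1 i ^ 2 = 1 := by
          rw [← EuclideanSpace.real_norm_sq_eq, norm_eq_of_mem_sphere v, one_pow]
        rw [← h, dotProduct]
        exact Finset.sum_congr rfl fun i _ => (sq _).symm
      have h := dotProduct_mulVec_self_le hS hlL hl hL v.1
      have hsq : ∑ i, (S *ᵥ v.1) i ^ 2 = S *ᵥ v.1 ⬝ᵥ S *ᵥ v.1 :=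
        Finset.sum_congr rfl fun i _ => sq _
      have hXv : v.1 ⬝ᵥ S *ᵥ v.1 = X v := by rw [hX]
      rw [hv, ← hsq, hXv] at h
      have h' := mul_le_mul_of_nonneg_left h
        (mul_nonneg (mul_nonneg zero_le_four hs) (Real.exp_nonneg (s * X v)))
      dsimp only
      linarith
  rw [hid', integral_sub (hint (by fun_prop)) (hint (by fun_prop)),
    integral_add (hint (by fun_prop)) (hint (by fun_prop)), integral_const_mul,
    integral_const_mul, integral_const_mul] at hle
  change 0 ≤ (2 * S.trace - 4 * s * (l * L)) * f 0 s + (4 * s * (l + L) - 2 * n) * f 1 s -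
    4 * s * f 2 s at hle
  rw [mul_div_cancel₀ _ hn'.ne']
  simp only [zero_add, Nat.reduceAdd]
  linarith

open Matrix in
/-- A quadratic form in a uniformly distributed unit vector is sub-Gaussian. -/
theorem hasSubgaussianMGF_quadratic {n : ℕ} (hn : 0 < n) {S : Matrix (Fin n) (Fin n) ℝ}
    (hS : S.IsSymm) {l L : ℝ} (hlL : l < L) (hl : ∀ x, l * (x ⬝ᵥ x) ≤ x ⬝ᵥ S *ᵥ x)
    (hL : ∀ x, x ⬝ᵥ S *ᵥ x ≤ L * (x ⬝ᵥ x)) :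
    HasSubgaussianMGF (fun v : Hypersphere n => v.1 ⬝ᵥ S *ᵥ v.1 - S.trace / n)
      (Real.toNNReal ((L - l) ^ 2 / (2 * (n + 2)))) (uniformSphere n) := by
  have := isProbabilityMeasure_uniformSphere hn
  have hXc : Continuous fun v : Hypersphere n => v.1 ⬝ᵥ S *ᵥ v.1 := by
    simp only [dotProduct, mulVec]
    fun_prop
  refine ⟨fun t => Continuous.integrable_of_hasCompactSupport (by fun_prop)
    (HasCompactSupport.of_compactSpace _), fun t => ?_⟩
  have hmgf : mgf (fun v : Hypersphere n => v.1 ⬝ᵥ S *ᵥ v.1 - S.trace / n) (uniformSphere n) t =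
      Real.exp (-(S.trace / n * t)) *
        ∫ v : Hypersphere n, Real.exp (t * (v.1 ⬝ᵥ S *ᵥ v.1)) ∂uniformSphere n := by
    rw [mgf, ← integral_const_mul]
    congr 1
    funext v
    dsimp only
    rw [← Real.exp_add, mul_sub, sub_eq_neg_add, mul_comm t (S.trace / n)]
  have hbound : ∫ v : Hypersphere n, Real.exp (t * (v.1 ⬝ᵥ S *ᵥ v.1)) ∂uniformSphere n ≤
      Real.exp (S.trace / n * t + (L - l) ^ 2 / (4 * (n + 2)) * t ^ 2) := by
    rcases le_total 0 t with ht | ht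
    · exact integral_exp_quadratic_le hn hS hlL hl hL ht
    -- For t ≤ 0, pass to -S and -t; the bounds become -L and -l, with the same gap.
    · have h := integral_exp_quadratic_le hn (S := -S) hS.neg (neg_lt_neg hlL)
        (fun x => by simpa [neg_mulVec] using hL x) (fun x => by simpa [neg_mulVec] using hl x)
        (neg_nonneg.2 ht)
      simp only [neg_mulVec, dotProduct_neg, neg_mul_neg, trace_neg] at h
      refine h.trans_eq ?_
      congr 1
      ring
  rw [hmgf]
  refine (mul_le_mul_of_nonneg_left hbound (Real.exp_nonneg _)).trans_eq ?_
  rw [← Real.exp_add, Real.coe_toNNReal _ (by positivity)]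
  congr 1
  field_simp
  ring

/-! ### Reduction from Hermitian to real symmetric matrices -/

/-- The entrywise real part of a complex matrix. -/
def realPart {n : ℕ} (A : Matrix (Fin n) (Fin n) ℂ) : Matrix (Fin n) (Fin n) ℝ :=
  A.map Complex.re

theorem isSymm_realPart {n : ℕ} {A : Matrix (Fin n) (Fin n) ℂ} (hA : A.IsHermitian) :
    (realPart A).IsSymm := by
  ext i j
  have h := congrArg Complex.re (hA.apply i j)
  simpa [realPart] using h

open Matrix in
theorem quadForm_eq {n : ℕ} {A : Matrix (Fin n) (Fin n) ℂ} (hA : A.IsHermitian)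
    (v : EuclideanSpace ℝ (Fin n)) :
    quadForm A v = ((v ⬝ᵥ realPart A *ᵥ v : ℝ) : ℂ) := by
  apply Complex.ext
  · simp [quadForm, dotProduct, mulVec, realPart]
  · simpa [quadForm] using hA.im_star_dotProduct_mulVec_self fun i => (v i : ℂ)

theorem trace_eq_trace_realPart {n : ℕ} {A : Matrix (Fin n) (Fin n) ℂ} (hA : A.IsHermitian) :
    A.trace = ((realPart A).trace : ℂ) := by
  simp only [Matrix.trace, realPart, Matrix.diag_apply, Matrix.map_apply, Complex.ofReal_sum]
  exact Finset.sum_congr rfl fun i _ => (hA.coe_re_apply_self i).symm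

-- A - λ_min is positive semidefinite over ℂ; testing it on real vectors sees only the real part of
-- A. The eigenvalues of `realPart A` itself are never needed.
open Matrix in
open scoped MatrixOrder in
theorem lambdaMin_mul_le {n : ℕ} {A : Matrix (Fin n) (Fin n) ℂ} (hA : A.IsHermitian)
    (x : Fin n → ℝ) : lambdaMin hA * (x ⬝ᵥ x) ≤ x ⬝ᵥ realPart A *ᵥ x := by
  have h : algebraMap ℝ (Matrix (Fin n) (Fin n) ℂ) (lambdaMin hA) ≤ A := by
    rw [algebraMap_le_iff_le_spectrum (ha := hA.isSelfAdjoint)]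
    rw [hA.spectrum_real_eq_range_eigenvalues]
    rintro _ ⟨i, rfl⟩
    exact ciInf_le (Set.finite_range _).bddBelow i
  have h' := (Matrix.le_iff.1 h).re_dotProduct_nonneg fun i => (x i : ℂ)
  have hq := congrArg Complex.re (quadForm_eq hA (WithLp.toLp 2 x))
  simp only [quadForm, Complex.ofReal_re] at hq
  rw [sub_mulVec, dotProduct_sub, map_sub, Algebra.algebraMap_eq_smul_one, smul_mulVec,
    one_mulVec, dotProduct_smul, RCLike.smul_re] at h'
  have hx : RCLike.re (star (fun i => (x i : ℂ)) ⬝ᵥ fun i => (x i : ℂ)) = x ⬝ᵥ x := by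
    simp [dotProduct]
  rw [hx] at h'
  have h'' := h'.trans_eq (congrArg₂ (· - ·) hq rfl)
  exact sub_nonneg.1 h''

theorem lambdaMin_neg {n : ℕ} {A : Matrix (Fin n) (Fin n) ℂ} (hA : A.IsHermitian) :
    lambdaMin hA.neg = -lambdaMax hA := by
  have h : Set.range hA.neg.eigenvalues = -Set.range hA.eigenvalues := by
    rw [← hA.spectrum_real_eq_range_eigenvalues, ← hA.neg.spectrum_real_eq_range_eigenvalues,
      spectrum.neg_eq]
  rw [lambdaMin, lambdaMax, iInf, iSup, h, Real.sInf_def, neg_neg]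

open Matrix in
theorem le_lambdaMax_mul {n : ℕ} {A : Matrix (Fin n) (Fin n) ℂ} (hA : A.IsHermitian)
    (x : Fin n → ℝ) : x ⬝ᵥ realPart A *ᵥ x ≤ lambdaMax hA * (x ⬝ᵥ x) := by
  have h := lambdaMin_mul_le hA.neg x
  have hr : realPart (-A) = -realPart A := by ext; simp [realPart]
  rw [lambdaMin_neg hA, hr, neg_mulVec, dotProduct_neg] at h
  linarith

theorem lambdaMin_le_lambdaMax {n : ℕ} (hn : 0 < n) {A : Matrix (Fin n) (Fin n) ℂ}
    (hA : A.IsHermitian) : lambdaMin hA ≤ lambdaMax hA :=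
  (ciInf_le (Set.finite_range _).bddBelow ⟨0, hn⟩).trans
    (le_ciSup (Set.finite_range hA.eigenvalues).bddAbove ⟨0, hn⟩)

open Matrix in
theorem norm_trace_sub_averagedEstimator {n nv : ℕ} (hnv : 0 < nv)
    {A : Matrix (Fin n) (Fin n) ℂ} (hA : A.IsHermitian)
    (v : Fin nv → EuclideanSpace ℝ (Fin n)) :
    ‖(n : ℂ)⁻¹ * A.trace - averagedEstimator A v‖ =
      (nv : ℝ)⁻¹ * |∑ l, (v l ⬝ᵥ realPart A *ᵥ v l - (realPart A).trace / n)| := by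
  have hnv' : (nv : ℝ) ≠ 0 := by exact_mod_cast hnv.ne'
  have h : (n : ℂ)⁻¹ * A.trace - averagedEstimator A v =
      (((n : ℝ)⁻¹ * (realPart A).trace - (nv : ℝ)⁻¹ * ∑ l, v l ⬝ᵥ realPart A *ᵥ v l : ℝ) : ℂ) := by
    rw [averagedEstimator, trace_eq_trace_realPart hA]
    simp only [quadForm_eq hA]
    push_cast
    rfl
  have habs (a : ℝ) : (nv : ℝ)⁻¹ * |a| = |(nv : ℝ)⁻¹ * a| := by
    rw [abs_mul, abs_inv, Nat.abs_cast]
  rw [h, Complex.norm_real, Real.norm_eq_abs, habs, ← abs_neg, Finset.sum_sub_distrib]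
  congr 1
  simp only [Finset.sum_const, Finset.card_univ, Fintype.card_fin, nsmul_eq_mul]
  field_simp
  ring

-- Handles the degenerate case λ_min = λ_max, where the estimator is exact.
open Matrix in
theorem quadratic_eq_trace_div {n : ℕ} (hn : 0 < n) {S : Matrix (Fin n) (Fin n) ℝ} {c : ℝ}
    (hS : ∀ x, x ⬝ᵥ S *ᵥ x = c * (x ⬝ᵥ x)) (v : Hypersphere n) :
    v.1 ⬝ᵥ S *ᵥ v.1 = S.trace / n := by
  have hn' : (n : ℝ) ≠ 0 := by exact_mod_cast hn.ne'
  have hv : v.1 ⬝ᵥ v.1 = 1 := by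
    have h : ∑ i, v.1 i ^ 2 = 1 := by
      rw [← EuclideanSpace.real_norm_sq_eq, norm_eq_of_mem_sphere v, one_pow]
    rw [← h, dotProduct]
    exact Finset.sum_congr rfl fun i _ => (sq _).symm
  have hd (i : Fin n) : S i i = c := by simpa using hS (Pi.single i 1)
  rw [hS, hv, Matrix.trace]
  simp only [diag_apply, hd]
  simp [hn']

/-! ### Tail bound for the average -/

open Matrix in
/-- Two-sided tail bound for sums of independent quadratic forms in uniformly distributed
unit vectors. -/
theorem measure_abs_sum_quadratic_ge_le {n nv : ℕ} (hn : 0 < n) (hnv : 0 < nv)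
    {S : Matrix (Fin n) (Fin n) ℝ}
    (hS : S.IsSymm) {l L : ℝ} (hlL : l < L) (hl : ∀ x, l * (x ⬝ᵥ x) ≤ x ⬝ᵥ S *ᵥ x)
    (hL : ∀ x, x ⬝ᵥ S *ᵥ x ≤ L * (x ⬝ᵥ x))
    {Ω : Type*} [MeasurableSpace Ω] {P : Measure Ω} [IsProbabilityMeasure P]
    {v : Fin nv → Ω → Hypersphere n} (hv_indep : iIndepFun v P)
    (hv_unif : ∀ l, HasLaw (v l) (uniformSphere n) P) {ε : ℝ} (hε : 0 < ε) :
    P.real {ω | nv * (ε * (L - l)) ≤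
        |∑ l, ((v l ω).1 ⬝ᵥ S *ᵥ (v l ω).1 - S.trace / n)|} ≤
      2 * Real.exp (-(nv * (n + 2) * ε ^ 2)) := by
  obtain ⟨Y, hY⟩ : ∃ Y : Hypersphere n → ℝ,
    Y = fun v => v.1 ⬝ᵥ S *ᵥ v.1 - S.trace / n := ⟨_, rfl⟩
  have hYm : Measurable Y := by
    have : Continuous Y := by
      rw [hY]
      simp only [dotProduct, mulVec]
      fun_prop
    exact this.measurable
  obtain ⟨c, hc⟩ : ∃ c, c = Real.toNNReal ((L - l) ^ 2 / (2 * (n + 2))) := ⟨_, rfl⟩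
  have hsub (i : Fin nv) : HasSubgaussianMGF (Y ∘ v i) c P := by
    refine HasSubgaussianMGF.of_map (hv_unif i).aemeasurable ?_
    rw [(hv_unif i).map_eq, hY, hc]
    exact hasSubgaussianMGF_quadratic hn hS hlL hl hL
  have hind : iIndepFun (fun i => Y ∘ v i) P := hv_indep.comp (fun _ => Y) fun _ => hYm
  have hsum := HasSubgaussianMGF.sum_of_iIndepFun hind (c := fun _ => c) (s := Finset.univ)
    fun i _ => hsub i
  have hnn : 0 ≤ nv * (ε * (L - l)) :=
    mul_nonneg nv.cast_nonneg (mul_nonneg hε.le (sub_pos.2 hlL).le)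
  have h1 := hsum.measure_ge_le hnn
  have h2 := hsum.neg.measure_ge_le hnn
  -- The summed proxy is nv · τ, so (L-l)² and one factor nv cancel.
  have hexp : -(nv * (ε * (L - l))) ^ 2 / (2 * ((∑ _i : Fin nv, c : NNReal) : ℝ)) =
      -(nv * (n + 2) * ε ^ 2) := by
    have h3 : (c : ℝ) = (L - l) ^ 2 / (2 * (n + 2)) := by
      rw [hc, Real.coe_toNNReal _ (by positivity)]
    have h4 : (nv : ℝ) ≠ 0 := by exact_mod_cast hnv.ne'
    have h5 : L - l ≠ 0 := (sub_pos.2 hlL).ne'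
    have h6 : (n : ℝ) + 2 ≠ 0 := by positivity
    simp only [Finset.sum_const, Finset.card_univ, Fintype.card_fin, nsmul_eq_mul,
      NNReal.coe_mul, NNReal.coe_natCast, h3]
    field_simp
  rw [hexp] at h1 h2
  have hsubset : {ω | nv * (ε * (L - l)) ≤
        |∑ l, ((v l ω).1 ⬝ᵥ S *ᵥ (v l ω).1 - S.trace / n)|} ⊆
      {ω | nv * (ε * (L - l)) ≤ ∑ i, (Y ∘ v i) ω} ∪
        {ω | nv * (ε * (L - l)) ≤ (-fun ω => ∑ i, (Y ∘ v i) ω) ω} := by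
    intro ω hω
    simp only [Set.mem_ofPred_eq, le_abs] at hω
    rw [hY]
    exact hω
  calc _ ≤ _ := measureReal_mono hsubset
    _ ≤ _ := measureReal_union_le _ _
    _ ≤ _ := add_le_add h1 h2
    _ = _ := by ring

end TraceEstimation

theorem mainTheorem5 {n nv : ℕ} (hn : 0 < n) (hnv : 0 < nv)
    (A : Matrix (Fin n) (Fin n) ℂ) (hA : A.IsHermitian)
    {Ω : Type*} [MeasurableSpace Ω] (P : Measure Ω) [IsProbabilityMeasure P]
    (v : Fin nv → Ω → TraceEstimation.Hypersphere n)
    (hv_indep : iIndepFun v P)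
    (hv_unif : ∀ l, HasLaw (v l) (TraceEstimation.uniformSphere n) P)
    (ε : ℝ) (hε : 0 < ε) :
    P.real {ω | ε * (TraceEstimation.lambdaMax hA - TraceEstimation.lambdaMin hA) <
        ‖(n : ℂ)⁻¹ * A.trace -
          TraceEstimation.averagedEstimator A (fun l => (v l ω : EuclideanSpace ℝ (Fin n)))‖} ≤
      2 * n * Real.exp (-(nv * (n + 2) * ε ^ 2)) := by
  have hnv' : (0 : ℝ) < nv := by exact_mod_cast hnv
  have hn' : (1 : ℝ) ≤ n := by exact_mod_cast hn
  simp only [TraceEstimation.norm_trace_sub_averagedEstimator hnv hA]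
  rcases (TraceEstimation.lambdaMin_le_lambdaMax hn hA).eq_or_lt with heq | hlt
  -- With a zero gap, both sides of the strict inequality are 0 and the event is empty.
  · have h0 (u : TraceEstimation.Hypersphere n) :=
      TraceEstimation.quadratic_eq_trace_div hn (S := TraceEstimation.realPart A)
        (fun x => le_antisymm (TraceEstimation.le_lambdaMax_mul hA x)
          (heq ▸ TraceEstimation.lambdaMin_mul_le hA x)) u
    simp only [h0, heq, sub_self, Finset.sum_const_zero, abs_zero, mul_zero, lt_self_iff_false,
      Set.ofPred_false, measureReal_empty]
    positivity
  · have h := TraceEstimation.measure_abs_sum_quadratic_ge_le hn hnv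
      (TraceEstimation.isSymm_realPart hA) hlt
      (TraceEstimation.lambdaMin_mul_le hA) (TraceEstimation.le_lambdaMax_mul hA) hv_indep
      hv_unif hε
    refine (measureReal_mono fun ω hω => ?_).trans (h.trans ?_)
    · rw [Set.mem_ofPred_eq, ← div_eq_inv_mul, lt_div_iff₀ hnv'] at hω
      rw [Set.mem_ofPred_eq, mul_comm]
      exact hω.le
    · exact mul_le_mul_of_nonneg_right (by linarith) (Real.exp_nonneg _)
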